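/- Let $G$ be a finite group and let $X$ be a finite-dimensional faithful complex representation of $G$ defined over $\mathbb{R}$: $X$ carries a conjugate-linear involution $x\mapsto\overline{x}$ commuting with the action of $G$, and $X(\mathbb{R})=\{x\in X:\overline{x}=x\}$. Let $n=\dim_{\mathbb{C}}X$, and let $h$ be a $G$-invariant Hermitian inner product on $X$ with underlying real metric $g_h=\operatorname{Re}h$. Let $\mathbb{R}[X]^G$ be the ring of $G$-invariant polynomial functions $f:X\to\mathbb{C}$ with $f(\overline{x})=\overline{f(x)}$ for all $x$, let $Y=X/\!/G=\operatorname{Spec}\mathbb{R}[X]^G$ with quotient map $\pi:X\to Y$ (on complex points), let $Y(\mathbb{R})$ be the set of real points of $Y$, and let $L=\pi(X(\mathbb{R}))\subseteq Y(\mathbb{R})$. Equip $Y$ with the quotient distance $d(\pi(x),\pi(x'))=\min_{g\in G}\|x-gx'\|_{g_h}$, and $Y(\mathbb{R})$ with the measure \[ \operatorname{vol}_{Y(\mathbb{R})}(U)=\frac{1}{|G|}\,\mathcal{H}^n_{(X,g_h)}\bigl(\pi^{-1}(U)\bigr), \] where $\mathcal{H}^n$ is the $n$-dimensional Hausdorff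 measure and $U\subseteq Y(\mathbb{R})$ is measurable, i.e. $\pi^{-1}(U)$ is Borel. For $r>0$ let $B_{Y(\mathbb{R})}(r)\subseteq Y(\mathbb{R})$ be the (open or closed) ball of radius $r$ centered at $\pi(0)$. Then $B_{Y(\mathbb{R})}(r)$ and $L\cap B_{Y(\mathbb{R})}(r)$ are measurable, $0<\operatorname{vol}_{Y(\mathbb{R})}(B_{Y(\mathbb{R})}(r))<\infty$, and \[ \frac{\operatorname{vol}_{Y(\mathbb{R})}\bigl(L\cap B_{Y(\mathbb{R})}(r)\bigr)}{\operatorname{vol}_{Y(\mathbb{R})}\bigl(B_{Y(\mathbb{R})}(r)\bigr)}=\frac{1}{\#\operatorname{Inv}(G)},\qquad \operatorname{Inv}(G)=\{\sigma\in G:\sigma^2=\mathrm{id}\}. \] -/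

import Mathlib

open MeasureTheory Measure
open scoped ENNReal

noncomputable section

namespace RealQuotient

/-- A real structure on a complex vector space `X`: a conjugate-linear involution. It exhibits `X`
as the complexification of the real vector space of its fixed points. -/
structure RealStructure (X : Type*) [AddCommGroup X] [Module ℂ X] where
  conj : X →ₛₗ[starRingEnd ℂ] X
  conj_conj : ∀ x, conj (conj x) = x

section Algebra

variable {X : Type*} [AddCommGroup X] [Module ℂ X] {G : Type*} [Group G]

/-- The real points `X(ℝ)`: the vectors fixed by the conjugation. -/
def RealStructure.realPoints (c : RealStructure X) : Set X := {x | c.conj x = x}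

/-- A complex representation is defined over `ℝ` when `G` acts by real automorphisms, that is, the
action commutes with the conjugation. -/
def IsDefinedOverReals (c : RealStructure X) (ρ : Representation ℂ G X) : Prop :=
  ∀ g x, ρ g (c.conj x) = c.conj (ρ g x)

variable (X) in
/-- The ring `ℂ[X]` of regular (polynomial) functions on the vector space `X`. -/
def coordinateRing : Subalgebra ℂ (X → ℂ) :=
  Algebra.adjoin ℂ (Set.range fun φ : Module.Dual ℂ X => (φ : X → ℂ))

/-- The ring `ℝ[X]^G` of the `G`-invariant regular functions `X → ℂ` that are defined over `ℝ`,
i.e. satisfy `f (conj x) = conj (f x)`. -/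
def invariantRing (c : RealStructure X) (ρ : Representation ℂ G X) : Subalgebra ℝ (X → ℂ) where
  carrier := {f | f ∈ coordinateRing X ∧ (∀ x, f (c.conj x) = starRingEnd ℂ (f x)) ∧
    ∀ g x, f (ρ g x) = f x}
  mul_mem' := by
    rintro f f' ⟨h₁, h₂, h₃⟩ ⟨h₁', h₂', h₃'⟩
    exact ⟨mul_mem h₁ h₁', fun x => by simp [h₂, h₂'], fun g x => by simp [h₃, h₃']⟩
  add_mem' := by
    rintro f f' ⟨h₁, h₂, h₃⟩ ⟨h₁', h₂', h₃'⟩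
    exact ⟨add_mem h₁ h₁', fun x => by simp [h₂, h₂'], fun g x => by simp [h₃, h₃']⟩
  algebraMap_mem' := by
    intro r
    refine ⟨(coordinateRing X).algebraMap_mem (r : ℂ), fun x => ?_, fun g x => rfl⟩
    simp [Pi.algebraMap_apply]

/-- The complex points of the affine variety `Y = X // G = Spec ℝ[X]^G`, that is, the
`ℝ`-algebra homomorphisms `ℝ[X]^G → ℂ`. -/
def QuotPoints (c : RealStructure X) (ρ : Representation ℂ G X) : Type _ :=
  invariantRing c ρ →ₐ[ℝ] ℂ

/-- The quotient map `π : X → Y` induced by the inclusion `ℝ[X]^G ⊆ ℝ[X]`: the point `x` goes to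
evaluation at `x`. -/
def proj (c : RealStructure X) (ρ : Representation ℂ G X) (x : X) : QuotPoints c ρ :=
  (Pi.evalAlgHom ℝ (fun _ : X => ℂ) x).comp (invariantRing c ρ).val

/-- The real points `Y(ℝ)`, i.e. the homomorphisms `ℝ[X]^G → ℝ`, as a subset of `Y`. -/
def quotRealPoints (c : RealStructure X) (ρ : Representation ℂ G X) : Set (QuotPoints c ρ) :=
  Set.range fun y : invariantRing c ρ →ₐ[ℝ] ℝ => (Complex.ofRealAm.comp y : _ →ₐ[ℝ] ℂ)

/-- The real image `L = π(X(ℝ))`. -/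
def realImage (c : RealStructure X) (ρ : Representation ℂ G X) : Set (QuotPoints c ρ) :=
  proj c ρ '' c.realPoints

end Algebra

section Metric

variable {X : Type*} [NormedAddCommGroup X] [InnerProductSpace ℂ X] {G : Type*} [Group G]

/-- The quotient distance on `Y`: the distance in `X` between the fibres of `π`, which are the
orbits of `G`. The norm distance on `X` is the one of the real part of the Hermitian metric. -/
def quotDist (c : RealStructure X) (ρ : Representation ℂ G X) (y y' : QuotPoints c ρ) : ℝ :=
  sInf {d | ∃ x x', proj c ρ x = y ∧ proj c ρ x' = y' ∧ d = dist x x'}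

/-- The open ball of radius `r` about `π 0` in `Y(ℝ)`. -/
def quotBall (c : RealStructure X) (ρ : Representation ℂ G X) (r : ℝ) : Set (QuotPoints c ρ) :=
  {y ∈ quotRealPoints c ρ | quotDist c ρ y (proj c ρ 0) < r}

/-- The closed ball of radius `r` about `π 0` in `Y(ℝ)`. -/
def quotClosedBall (c : RealStructure X) (ρ : Representation ℂ G X) (r : ℝ) : Set (QuotPoints c ρ) :=
  {y ∈ quotRealPoints c ρ | quotDist c ρ y (proj c ρ 0) ≤ r}

variable [MeasurableSpace X]

/-- The quotient σ-algebra: `U ⊆ Y` is measurable when `π⁻¹(U)` is a Borel set of `X`. -/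
instance (c : RealStructure X) (ρ : Representation ℂ G X) : MeasurableSpace (QuotPoints c ρ) :=
  MeasurableSpace.map (proj c ρ) inferInstance

theorem measurable_proj (c : RealStructure X) (ρ : Representation ℂ G X) :
    Measurable (proj c ρ) := fun _ h => h

/-- The measure on `Y(ℝ)` with `vol U = |G|⁻¹ * ℋⁿ (π⁻¹ U)` for measurable `U ⊆ Y(ℝ)`, where
`n = dim_ℂ X` and `ℋⁿ` is the Hausdorff measure of `X` with the underlying real metric; see
`vol_apply`. As a measure on `Y` it is carried by `Y(ℝ)`. -/
def vol [BorelSpace X] (c : RealStructure X) (ρ : Representation ℂ G X) : Measure (QuotPoints c ρ) :=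
  ((Nat.card G : ℝ≥0∞)⁻¹ •
    (μH[(Module.finrank ℂ X : ℝ)] : Measure X).map (proj c ρ)).restrict (quotRealPoints c ρ)

theorem vol_apply [BorelSpace X] (c : RealStructure X) (ρ : Representation ℂ G X)
    {U : Set (QuotPoints c ρ)} (hU : MeasurableSet U) (hUr : U ⊆ quotRealPoints c ρ) :
    vol c ρ U = (Nat.card G : ℝ≥0∞)⁻¹ * μH[(Module.finrank ℂ X : ℝ)] (proj c ρ ⁻¹' U) := by
  rw [vol, restrict_apply hU, Set.inter_eq_left.2 hUr, Measure.smul_apply,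
    map_apply (measurable_proj c ρ) hU, smul_eq_mul]

end Metric

/-- `Inv(G)`: the elements with `σ² = 1`, the identity included. -/
def involutions (G : Type*) [Group G] : Set G := {σ | σ ^ 2 = 1}

end RealQuotient

end

open Module

namespace RealQuotient

/-! ### Fibres and real points of the quotient -/

section Algebra

variable {X : Type*} [AddCommGroup X] [Module ℂ X] {G : Type*} [Group G]

/-! A point π(x) is real exactly when conj x lies in the orbit of x. So the preimage of Y(ℝ) is the
union over g of the real subspaces V_g = {x | conj x = g x}, while the preimage of L is V_1 = X(ℝ)
alone.

Each V_g is totally real and is fixed pointwise by g². If g² ≠ 1, faithfulness puts V_g in a proper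
complex subspace, so its real dimension is below n and it is ℋⁿ-null; V_g ∩ V_k with g ≠ k is null
because g and k agree on it (`finrank_lt_of_totallyReal`). If σ² = 1, the unitary `involutionRoot ρ
σ` carries V_1 onto V_σ, so both meet a centred ball in equal measure
(`hausdorffMeasure_twistedRealPoints_inter`). Hence the ball has #Inv(G) times the volume of its
part in L. -/

theorem dual_mem_coordinateRing (φ : Dual ℂ X) : (φ : X → ℂ) ∈ coordinateRing X :=
  Algebra.subset_adjoin ⟨φ, rfl⟩

theorem const_mem_coordinateRing (a : ℂ) : (fun _ : X => a) ∈ coordinateRing X :=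
  (coordinateRing X).algebraMap_mem a

/-- The linear form `x ↦ conj (φ (conj x))`. -/
def RealStructure.conjDual (c : RealStructure X) (φ : Dual ℂ X) : Dual ℂ X where
  toFun x := starRingEnd ℂ (φ (c.conj x))
  map_add' x y := by simp
  map_smul' a x := by simp

theorem conj_comp_mem_coordinateRing (c : RealStructure X) {f : X → ℂ}
    (hf : f ∈ coordinateRing X) :
    (fun x => starRingEnd ℂ (f (c.conj x))) ∈ coordinateRing X := by
  induction hf using Algebra.adjoin_induction with
  | mem f hf =>
    obtain ⟨φ, rfl⟩ := hf
    exact dual_mem_coordinateRing (c.conjDual φ)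
  | algebraMap a => exact const_mem_coordinateRing (starRingEnd ℂ a)
  | add f f' _ _ h h' => simpa [Pi.add_def] using add_mem h h'
  | mul f f' _ _ h h' => simpa [Pi.mul_def] using mul_mem h h'

/-- If all real invariants agree at `x` and `y`, then so do all complex invariants. -/
theorem invariant_eq_of_proj_eq {c : RealStructure X} {ρ : Representation ℂ G X}
    (hreal : IsDefinedOverReals c ρ) {x y : X} (h : proj c ρ x = proj c ρ y) {f : X → ℂ}
    (hf : f ∈ coordinateRing X) (hinv : ∀ g z, f (ρ g z) = f z) : f x = f y := by
  have key : ∀ f' ∈ invariantRing c ρ, f' x = f' y := fun f' hf' =>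
    DFunLike.congr_fun (F := invariantRing c ρ →ₐ[ℝ] ℂ) h ⟨f', hf'⟩
  have hc := conj_comp_mem_coordinateRing c hf
  -- Up to constants, `f` splits into two real invariants; the factor `I` makes the second one real.
  have h₁ := key (fun z => f z + starRingEnd ℂ (f (c.conj z)))
    ⟨add_mem hf hc, fun z => by simp [c.conj_conj, add_comm],
      fun g z => by simp [hinv, ← hreal g z]⟩
  have h₂ := key (fun z => Complex.I * (f z - starRingEnd ℂ (f (c.conj z))))
    ⟨mul_mem (const_mem_coordinateRing Complex.I) (sub_mem hf hc),
      fun z => by simp [c.conj_conj]; ring, fun g z => by simp [hinv, ← hreal g z]⟩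
  have h₃ := mul_left_cancel₀ Complex.I_ne_zero h₂
  linear_combination (h₁ + h₃) / 2

/-- The fibres of the quotient map are the orbits. -/
theorem proj_eq_proj_iff [Finite G] {c : RealStructure X} {ρ : Representation ℂ G X}
    (hreal : IsDefinedOverReals c ρ) {x y : X} :
    proj c ρ x = proj c ρ y ↔ ∃ g, ρ g x = y := by
  constructor
  · intro h
    by_contra! hne
    have := Fintype.ofFinite G
    obtain ⟨φ, hφ⟩ := exists_dual_forall_apply_ne_zero (K := ℂ) (fun g => ρ g x - y)
      fun g => sub_ne_zero.2 (hne g)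
    -- This product over the orbit is invariant; it vanishes at `y` through the factor of `1`, but
    -- not at `x`.
    have hmem : (∏ g, fun z => φ (ρ g z) - φ y) ∈ coordinateRing X :=
      prod_mem fun g _ => sub_mem (dual_mem_coordinateRing (φ ∘ₗ ρ g))
        (const_mem_coordinateRing (φ y))
    have heq := invariant_eq_of_proj_eq hreal h hmem fun g z => by
      simp only [Finset.prod_apply]
      exact Fintype.prod_equiv (Equiv.mulRight g) _ _ fun k => by simp
    simp only [Finset.prod_apply] at heq
    rw [Finset.prod_eq_zero (f := fun g => φ (ρ g y) - φ y) (Finset.mem_univ (1 : G)) (by simp),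
      Finset.prod_eq_zero_iff] at heq
    obtain ⟨g, -, hg⟩ := heq
    exact hφ g (by rw [map_sub, hg])
  · rintro ⟨g, rfl⟩
    exact AlgHom.ext fun f => (f.2.2.2 g x).symm

theorem mem_quotRealPoints_iff {c : RealStructure X} {ρ : Representation ℂ G X}
    {y : invariantRing c ρ →ₐ[ℝ] ℂ} :
    y ∈ quotRealPoints c ρ ↔ ∀ f, starRingEnd ℂ (y f) = y f := by
  constructor
  · rintro ⟨y, rfl⟩ f
    exact Complex.conj_ofReal _
  · intro h
    have hre : ∀ f, ((y f).re : ℂ) = y f := fun f => Complex.conj_eq_iff_re.1 (h f)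
    refine ⟨{ toFun := fun f => (y f).re, map_one' := by simp, map_zero' := by simp,
              map_add' := by simp, map_mul' := fun f f' => ?_,
              commutes' := fun a => by simp }, ?_⟩
    · apply Complex.ofReal_injective
      rw [Complex.ofReal_mul, hre, hre, hre, map_mul]
    · exact AlgHom.ext hre

/-- Real invariants take conjugate values at `x` and `conj x`, so all are real at `x` iff these
points share a fibre, that is, an orbit. -/
theorem proj_mem_quotRealPoints_iff [Finite G] {c : RealStructure X} {ρ : Representation ℂ G X}
    (hreal : IsDefinedOverReals c ρ) {x : X} :
    proj c ρ x ∈ quotRealPoints c ρ ↔ ∃ g, c.conj x = ρ g x := by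
  have h : proj c ρ x ∈ quotRealPoints c ρ ↔ proj c ρ x = proj c ρ (c.conj x) := by
    refine mem_quotRealPoints_iff.trans ⟨fun h => AlgHom.ext fun f => ?_, fun h f => ?_⟩
    · exact (h f).symm.trans (f.2.2.1 x).symm
    · exact (f.2.2.1 x).symm.trans
        (DFunLike.congr_fun (F := invariantRing c ρ →ₐ[ℝ] ℂ) h f).symm
  rw [h, proj_eq_proj_iff hreal]
  simp only [eq_comm]

/-- `G` preserves X(ℝ), so the orbit of a real vector is entirely real. -/
theorem proj_mem_realImage_iff [Finite G] {c : RealStructure X} {ρ : Representation ℂ G X}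
    (hreal : IsDefinedOverReals c ρ) {x : X} :
    proj c ρ x ∈ realImage c ρ ↔ c.conj x = x := by
  constructor
  · rintro ⟨z, hz, h⟩
    obtain ⟨g, rfl⟩ := (proj_eq_proj_iff hreal).1 h
    rw [← hreal, show c.conj z = z from hz]
  · exact fun h => ⟨x, h, rfl⟩

/-! ### Totally real subspaces and their dimensions -/

/-- The real subspace of the vectors on which the conjugation acts as `g`. -/
def twistedRealPoints (c : RealStructure X) (ρ : Representation ℂ G X) (g : G) :
    Submodule ℝ X where
  carrier := {x | c.conj x = ρ g x}
  add_mem' {x y} hx hy := by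
    simp only [Set.mem_ofPred_eq] at *
    rw [map_add, map_add, hx, hy]
  zero_mem' := by simp
  smul_mem' a x hx := by
    simp only [Set.mem_ofPred_eq] at *
    rw [← Complex.coe_smul, map_smulₛₗ, map_smul, hx, Complex.conj_ofReal]

theorem mem_twistedRealPoints {c : RealStructure X} {ρ : Representation ℂ G X} {g : G} {x : X} :
    x ∈ twistedRealPoints c ρ g ↔ c.conj x = ρ g x := Iff.rfl

theorem eq_zero_of_I_smul_mem_twistedRealPoints {c : RealStructure X}
    {ρ : Representation ℂ G X} {g : G} {x : X} (hx : x ∈ twistedRealPoints c ρ g)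
    (hIx : Complex.I • x ∈ twistedRealPoints c ρ g) : x = 0 := by
  have : IsAddTorsionFree X := .of_isTorsionFree ℂ X
  rw [mem_twistedRealPoints] at hx hIx
  rw [map_smulₛₗ, map_smul, Complex.conj_I, neg_smul, hx, _root_.neg_eq_self,
    smul_eq_zero_iff_right Complex.I_ne_zero] at hIx
  rw [← c.conj_conj x, hx, hIx, map_zero]

theorem map_sq_of_mem_twistedRealPoints {c : RealStructure X} {ρ : Representation ℂ G X}
    (hreal : IsDefinedOverReals c ρ) {g : G} {x : X} (hx : x ∈ twistedRealPoints c ρ g) :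
    ρ (g ^ 2) x = x := by
  rw [mem_twistedRealPoints] at hx
  rw [pow_two, map_mul, Module.End.mul_apply, ← hx, hreal, ← hx, c.conj_conj]

/-- The map `(x, y) ↦ x + I • y` on a real subspace. -/
def addISMul (V : Submodule ℝ X) : (V × V) →ₗ[ℝ] X where
  toFun p := p.1 + Complex.I • (p.2 : X)
  map_add' p q := by
    simp only [Prod.fst_add, Prod.snd_add, Submodule.coe_add, smul_add]
    abel
  map_smul' a p := by simp [smul_comm a Complex.I]

theorem addISMul_apply (V : Submodule ℝ X) (p : V × V) :
    addISMul V p = p.1 + Complex.I • (p.2 : X) := rfl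

theorem addISMul_injective {V : Submodule ℝ X} (hV : ∀ x ∈ V, Complex.I • x ∈ V → x = 0) :
    Function.Injective (addISMul V) := by
  refine (injective_iff_map_eq_zero (addISMul V)).2 fun p hp => ?_
  rw [addISMul_apply] at hp
  have h₂ : (p.2 : X) = 0 := by
    refine hV _ p.2.2 ?_
    rw [← neg_eq_of_add_eq_zero_right hp]
    exact V.neg_mem p.1.2
  rw [h₂, smul_zero, add_zero] at hp
  exact Prod.ext (Subtype.ext hp) (Subtype.ext h₂)

/-- A totally real subspace of a proper complex subspace has real dimension less than the complex
dimension of the ambient space. -/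
theorem finrank_lt_of_totallyReal [FiniteDimensional ℂ X] {V : Submodule ℝ X}
    (hV : ∀ x ∈ V, Complex.I • x ∈ V → x = 0) {W : Submodule ℂ X} (hVW : ∀ x ∈ V, x ∈ W)
    (hW : W ≠ ⊤) : finrank ℝ V < finrank ℂ X := by
  have : FiniteDimensional ℝ X := FiniteDimensional.complexToReal X
  have hF : ∀ p, addISMul V p ∈ W.restrictScalars ℝ := fun p =>
    add_mem (hVW _ p.1.2) (W.smul_mem _ (hVW _ p.2.2))
  have h₁ := LinearMap.finrank_le_finrank_of_injective
    (f := (addISMul V).codRestrict (W.restrictScalars ℝ) hF)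
    fun p q h => addISMul_injective hV (congrArg Subtype.val h)
  have h₂ : finrank ℝ (W.restrictScalars ℝ) = 2 * finrank ℂ W := finrank_real_of_complex W
  have h₃ := Submodule.finrank_lt hW
  rw [finrank_prod, h₂] at h₁
  omega

theorem finrank_twistedRealPoints_one [FiniteDimensional ℂ X] (c : RealStructure X)
    (ρ : Representation ℂ G X) : finrank ℝ (twistedRealPoints c ρ 1) = finrank ℂ X := by
  have : FiniteDimensional ℝ X := FiniteDimensional.complexToReal X
  have hmem : ∀ x, x ∈ twistedRealPoints c ρ 1 ↔ c.conj x = x := fun x => by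
    simp [mem_twistedRealPoints]
  have hsurj : Function.Surjective (addISMul (twistedRealPoints c ρ 1)) := by
    intro x
    -- The real and imaginary parts of `x` with respect to `c`.
    refine ⟨(⟨(2⁻¹ : ℂ) • (x + c.conj x), (hmem _).2 ?_⟩,
      ⟨(-Complex.I / 2) • (x - c.conj x), (hmem _).2 ?_⟩), ?_⟩
    · rw [map_smulₛₗ, map_add, c.conj_conj, add_comm, map_inv₀, map_ofNat]
    · rw [map_smulₛₗ, map_sub, c.conj_conj, ← neg_sub x, smul_neg, ← neg_smul]
      congr 1
      rw [map_div₀, map_neg, Complex.conj_I, map_ofNat, neg_neg, neg_div]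
    · rw [addISMul_apply, smul_smul, show Complex.I * (-Complex.I / 2) = 2⁻¹ by
        linear_combination (-1 / 2 : ℂ) * Complex.I_mul_I, ← smul_add, add_add_sub_cancel,
        ← two_smul ℂ x, smul_smul, inv_mul_cancel₀ two_ne_zero, one_smul]
  have h := (LinearEquiv.ofBijective _ ⟨addISMul_injective fun x hx hIx =>
    eq_zero_of_I_smul_mem_twistedRealPoints hx hIx, hsurj⟩).finrank_eq
  rw [finrank_prod, finrank_real_of_complex] at h
  omega

theorem eqLocus_ne_top_of_ne {ρ : Representation ℂ G X} (hfaithful : Function.Injective ρ)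
    {g k : G} (h : g ≠ k) : LinearMap.eqLocus (ρ g) (ρ k) ≠ ⊤ := fun htop =>
  h (hfaithful (LinearMap.eqLocus_eq_top.1 htop))

end Algebra

/-! ### Quotient distance and the unitary square root of an involution -/

section Metric

variable {X : Type*} [NormedAddCommGroup X] [InnerProductSpace ℂ X] {G : Type*} [Group G]

theorem norm_representation {ρ : Representation ℂ G X}
    (hinv : ∀ g x y, inner ℂ (ρ g x) (ρ g y) = inner ℂ x y) (g : G) (x : X) :
    ‖ρ g x‖ = ‖x‖ := by
  rw [@norm_eq_sqrt_re_inner ℂ, @norm_eq_sqrt_re_inner ℂ, hinv]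

/-- The fibre over π(0) is {0}, and all points of an orbit have the same norm. -/
theorem quotDist_proj_zero [Finite G] {c : RealStructure X} {ρ : Representation ℂ G X}
    (hreal : IsDefinedOverReals c ρ)
    (hinv : ∀ g x y, inner ℂ (ρ g x) (ρ g y) = inner ℂ x y) (x : X) :
    quotDist c ρ (proj c ρ x) (proj c ρ 0) = ‖x‖ := by
  have : {d | ∃ z z', proj c ρ z = proj c ρ x ∧ proj c ρ z' = proj c ρ 0 ∧ d = dist z z'}
      = {‖x‖} := by
    ext d
    constructor
    · rintro ⟨z, z', hz, hz', rfl⟩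
      obtain ⟨g, rfl⟩ := (proj_eq_proj_iff hreal).1 hz
      obtain ⟨k, rfl⟩ := (proj_eq_proj_iff hreal).1 hz'.symm
      simp [norm_representation hinv]
    · rintro rfl
      exact ⟨x, 0, rfl, rfl, (dist_zero_right x).symm⟩
  rw [quotDist, this, csInf_singleton]

theorem isClosed_twistedRealPoints [FiniteDimensional ℂ X] (c : RealStructure X)
    (ρ : Representation ℂ G X) (g : G) : IsClosed (twistedRealPoints c ρ g : Set X) :=
  have : FiniteDimensional ℝ X := FiniteDimensional.complexToReal X
  Submodule.closed_of_finiteDimensional _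

/-- For an involution `σ`, the unitary map which is `1` on the `1`-eigenspace of `σ` and `I` on the
`-1`-eigenspace. -/
noncomputable def involutionRoot (ρ : Representation ℂ G X) (σ : G) : X →ₗ[ℂ] X :=
  ((1 + Complex.I) / 2) • LinearMap.id + ((1 - Complex.I) / 2) • ρ σ

theorem involutionRoot_apply (ρ : Representation ℂ G X) (σ : G) (x : X) :
    involutionRoot ρ σ x = ((1 + Complex.I) / 2) • x + ((1 - Complex.I) / 2) • ρ σ x := rfl

theorem representation_involution_apply (ρ : Representation ℂ G X) {σ : G} (hσ : σ ^ 2 = 1)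
    (x : X) : ρ σ (ρ σ x) = x := by
  rw [← Module.End.mul_apply, ← map_mul, ← pow_two, hσ, map_one, Module.End.one_apply]

/-- The two coefficients have squared modulus 1/2, and the cross terms cancel because an involutive
unitary `ρ σ` is self-adjoint. -/
theorem norm_involutionRoot {ρ : Representation ℂ G X}
    (hinv : ∀ g x y, inner ℂ (ρ g x) (ρ g y) = inner ℂ x y) {σ : G} (hσ : σ ^ 2 = 1) (x : X) :
    ‖involutionRoot ρ σ x‖ = ‖x‖ := by
  have hsymm : inner ℂ (ρ σ x) x = inner ℂ x (ρ σ x) := by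
    rw [← hinv σ x, representation_involution_apply ρ hσ]
  have hI := Complex.I_mul_I
  have : inner ℂ (involutionRoot ρ σ x) (involutionRoot ρ σ x) = inner ℂ x x := by
    simp only [involutionRoot_apply, inner_add_left, inner_add_right, inner_smul_left,
      inner_smul_right, hinv, hsymm, map_div₀, map_add, map_sub, map_one, Complex.conj_I,
      map_ofNat]
    linear_combination (-1 / 2 * inner ℂ x x + 1 / 2 * inner ℂ x (ρ σ x)) * hI
  rw [@norm_eq_sqrt_re_inner ℂ, @norm_eq_sqrt_re_inner ℂ _ _ _ _ x, this]

theorem isometry_involutionRoot {ρ : Representation ℂ G X}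
    (hinv : ∀ g x y, inner ℂ (ρ g x) (ρ g y) = inner ℂ x y) {σ : G} (hσ : σ ^ 2 = 1) :
    Isometry (involutionRoot ρ σ) :=
  AddMonoidHomClass.isometry_of_norm _ (norm_involutionRoot hinv hσ)

/-- Conjugation swaps the two coefficients, and so does composition with `ρ σ`. No compatibility of
the inner product with `c` is needed. -/
theorem involutionRoot_mem_twistedRealPoints_iff {c : RealStructure X}
    {ρ : Representation ℂ G X} (hreal : IsDefinedOverReals c ρ)
    (hinv : ∀ g x y, inner ℂ (ρ g x) (ρ g y) = inner ℂ x y) {σ : G} (hσ : σ ^ 2 = 1) {x : X} :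
    involutionRoot ρ σ x ∈ twistedRealPoints c ρ σ ↔ x ∈ twistedRealPoints c ρ 1 := by
  have hconj : c.conj (involutionRoot ρ σ x) = ρ σ (involutionRoot ρ σ (c.conj x)) := by
    have h₁ : starRingEnd ℂ ((1 + Complex.I) / 2) = (1 - Complex.I) / 2 := by
      simp [map_ofNat, sub_eq_add_neg]
    have h₂ : starRingEnd ℂ ((1 - Complex.I) / 2) = (1 + Complex.I) / 2 := by
      rw [← h₁, Complex.conj_conj]
    rw [involutionRoot_apply, involutionRoot_apply, map_add, map_smulₛₗ, map_smulₛₗ, map_add,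
      map_smul, map_smul, representation_involution_apply ρ hσ, hreal, h₁, h₂, add_comm]
  have hρ : Function.Injective (ρ σ) := fun y z h => by
    rw [← representation_involution_apply ρ hσ y, h, representation_involution_apply ρ hσ]
  rw [mem_twistedRealPoints, mem_twistedRealPoints, hconj, hρ.eq_iff,
    (isometry_involutionRoot hinv hσ).injective.eq_iff, map_one, Module.End.one_apply]

/-! ### Hausdorff measure of the pieces -/

variable [MeasurableSpace X] [BorelSpace X]

theorem hausdorffMeasure_submodule_eq_zero [FiniteDimensional ℂ X] {V : Submodule ℝ X} {d : ℕ}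
    (h : finrank ℝ V < d) : μH[(d : ℝ)] (V : Set X) = 0 := by
  have : FiniteDimensional ℝ X := FiniteDimensional.complexToReal X
  have hdim : dimH (V : Set X) < ((d : NNReal) : ℝ≥0∞) := by
    rw [← Subtype.range_coe (s := (V : Set X)), ← Set.image_univ,
      (isometry_subtype_coe (s := (V : Set X))).dimH_image]
    rw [show dimH (Set.univ : Set (V : Set X)) = finrank ℝ V from
      Real.dimH_univ_eq_finrank V]
    exact_mod_cast h
  exact_mod_cast hausdorffMeasure_of_dimH_lt hdim

/-- Passing to the intrinsic measure of `V`, which is a Haar measure there, makes balls positive and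
finite. -/
theorem hausdorffMeasure_submodule_inter [FiniteDimensional ℂ X] (V : Submodule ℝ X)
    (S : Set X) : μH[(finrank ℝ V : ℝ)] ((V : Set X) ∩ S)
      = μH[(finrank ℝ V : ℝ)] (((↑) : V → X) ⁻¹' S) := by
  rw [← V.subtypeₗᵢ.isometry.hausdorffMeasure_image (Or.inl (Nat.cast_nonneg _))]
  congr 1
  exact (Subtype.image_preimage_coe (V : Set X) S).symm

theorem hausdorffMeasure_submodule_inter_pos [FiniteDimensional ℂ X] (V : Submodule ℝ X)
    {S : Set X} {r : ℝ} (hr : 0 < r) (hS : Metric.ball 0 r ⊆ S) :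
    0 < μH[(finrank ℝ V : ℝ)] ((V : Set X) ∩ S) := by
  have : FiniteDimensional ℝ X := FiniteDimensional.complexToReal X
  rw [hausdorffMeasure_submodule_inter]
  refine (Metric.measure_ball_pos μH[(finrank ℝ V : ℝ)] (0 : V) hr).trans_le
    (measure_mono fun x hx => hS ?_)
  simpa using hx

theorem hausdorffMeasure_submodule_inter_lt_top [FiniteDimensional ℂ X] (V : Submodule ℝ X)
    {S : Set X} {r : ℝ} (hS : S ⊆ Metric.closedBall 0 r) :
    μH[(finrank ℝ V : ℝ)] ((V : Set X) ∩ S) < ⊤ := by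
  have : FiniteDimensional ℝ X := FiniteDimensional.complexToReal X
  rw [hausdorffMeasure_submodule_inter]
  refine (measure_mono fun x hx => ?_).trans_lt
    (measure_closedBall_lt_top (μ := μH[(finrank ℝ V : ℝ)]) (x := (0 : V)) (r := r))
  simpa using hS hx

theorem hausdorffMeasure_twistedRealPoints_inter [FiniteDimensional ℂ X] {c : RealStructure X}
    {ρ : Representation ℂ G X} (hreal : IsDefinedOverReals c ρ)
    (hinv : ∀ g x y, inner ℂ (ρ g x) (ρ g y) = inner ℂ x y) {σ : G} (hσ : σ ^ 2 = 1)
    {S : Set X} {s : Set ℝ} (hS : ∀ x, x ∈ S ↔ ‖x‖ ∈ s) {d : ℝ} (hd : 0 ≤ d) :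
    μH[d] ((twistedRealPoints c ρ σ : Set X) ∩ S)
      = μH[d] ((twistedRealPoints c ρ 1 : Set X) ∩ S) := by
  have hiso := isometry_involutionRoot hinv hσ
  have hsurj : Function.Surjective (involutionRoot ρ σ) :=
    LinearMap.surjective_of_injective hiso.injective
  have hpre : (twistedRealPoints c ρ 1 : Set X) ∩ S
      = involutionRoot ρ σ ⁻¹' ((twistedRealPoints c ρ σ : Set X) ∩ S) := by
    ext x
    simp only [Set.mem_inter_iff, Set.mem_preimage, SetLike.mem_coe, hS,
      norm_involutionRoot hinv hσ, involutionRoot_mem_twistedRealPoints_iff hreal hinv hσ]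
  rw [hpre, ← hiso.hausdorffMeasure_image (s := _ ⁻¹' _) (Or.inl hd), Set.image_preimage_eq _ hsurj]

/-- The sets of vectors on which conjugation acts as `g` overlap in null sets, and only those with
`g ^ 2 = 1` have positive measure. -/
theorem hausdorffMeasure_iUnion_twistedRealPoints_inter [FiniteDimensional ℂ X] [Finite G]
    {c : RealStructure X} {ρ : Representation ℂ G X} (hreal : IsDefinedOverReals c ρ)
    (hfaithful : Function.Injective ρ)
    (hinv : ∀ g x y, inner ℂ (ρ g x) (ρ g y) = inner ℂ x y)
    {S : Set X} {s : Set ℝ} (hS : ∀ x, x ∈ S ↔ ‖x‖ ∈ s) (hSm : MeasurableSet S) :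
    μH[(finrank ℂ X : ℝ)] (⋃ g, (twistedRealPoints c ρ g : Set X) ∩ S)
      = (involutions G).ncard *
        μH[(finrank ℂ X : ℝ)] ((twistedRealPoints c ρ 1 : Set X) ∩ S) := by
  classical
  have := Fintype.ofFinite G
  rw [measure_iUnion₀, tsum_fintype]
  · have hterm : ∀ g, μH[(finrank ℂ X : ℝ)] ((twistedRealPoints c ρ g : Set X) ∩ S)
        = if g ∈ involutions G then
            μH[(finrank ℂ X : ℝ)] ((twistedRealPoints c ρ 1 : Set X) ∩ S) else 0 := by
      intro g
      split_ifs with hg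
      · exact hausdorffMeasure_twistedRealPoints_inter hreal hinv hg hS (Nat.cast_nonneg _)
      · refine measure_mono_null Set.inter_subset_left (hausdorffMeasure_submodule_eq_zero ?_)
        refine finrank_lt_of_totallyReal (W := LinearMap.eqLocus (ρ (g ^ 2)) (ρ 1))
          (fun x hx hIx => eq_zero_of_I_smul_mem_twistedRealPoints hx hIx) (fun x hx => ?_)
          (eqLocus_ne_top_of_ne hfaithful hg)
        rw [LinearMap.mem_eqLocus, map_sq_of_mem_twistedRealPoints hreal hx, map_one,
          Module.End.one_apply]
    rw [Finset.sum_congr rfl fun g _ => hterm g, ← Finset.sum_filter, Finset.sum_const, nsmul_eq_mul, Set.ncard_eq_toFinset_card']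
    congr 3
    ext g
    simp
  · intro g k hgk
    refine measure_mono_null (t := ((twistedRealPoints c ρ g ⊓ twistedRealPoints c ρ k :
      Submodule ℝ X) : Set X)) (fun x hx => ⟨hx.1.1, hx.2.1⟩)
      (hausdorffMeasure_submodule_eq_zero ?_)
    refine finrank_lt_of_totallyReal (W := LinearMap.eqLocus (ρ g) (ρ k))
      (fun x hx hIx => eq_zero_of_I_smul_mem_twistedRealPoints hx.1 hIx.1) (fun x hx => ?_)
      (eqLocus_ne_top_of_ne hfaithful hgk)
    exact LinearMap.mem_eqLocus.2 ((mem_twistedRealPoints.1 hx.1).symm.trans hx.2)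
  · exact fun g =>
      ((isClosed_twistedRealPoints c ρ g).measurableSet.inter hSm).nullMeasurableSet

end Metric

end RealQuotient

/-! ### The volume ratio -/

theorem theorem4p2 {X : Type*} [NormedAddCommGroup X] [InnerProductSpace ℂ X]
    [FiniteDimensional ℂ X] [MeasurableSpace X] [BorelSpace X]
    {G : Type*} [Group G] [Finite G]
    (c : RealQuotient.RealStructure X) (ρ : Representation ℂ G X)
    (hreal : RealQuotient.IsDefinedOverReals c ρ) (hfaithful : Function.Injective ρ)
    (hinv : ∀ g x y, inner ℂ (ρ g x) (ρ g y) = inner ℂ x y)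
    (r : ℝ) (hr : 0 < r) (B : Set (RealQuotient.QuotPoints c ρ))
    (hB : B = RealQuotient.quotBall c ρ r ∨ B = RealQuotient.quotClosedBall c ρ r) :
    MeasurableSet B ∧ MeasurableSet (RealQuotient.realImage c ρ ∩ B) ∧
      0 < RealQuotient.vol c ρ B ∧ RealQuotient.vol c ρ B < ⊤ ∧
      RealQuotient.vol c ρ (RealQuotient.realImage c ρ ∩ B) / RealQuotient.vol c ρ B
        = 1 / ((RealQuotient.involutions G).ncard : ENNReal) := by
  -- Encoding the ball by a set `s` of norms treats the open and closed cases together.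
  obtain ⟨S, s, hS, hSm, hball, hclosed, hBS⟩ : ∃ (S : Set X) (s : Set ℝ),
      (∀ x, x ∈ S ↔ ‖x‖ ∈ s) ∧ MeasurableSet S ∧ Metric.ball 0 r ⊆ S ∧
      S ⊆ Metric.closedBall 0 r ∧
      B = {y ∈ RealQuotient.quotRealPoints c ρ |
        RealQuotient.quotDist c ρ y (RealQuotient.proj c ρ 0) ∈ s} := by
    rcases hB with rfl | rfl
    · exact ⟨Metric.ball 0 r, Set.Iio r, by simp, measurableSet_ball, subset_rfl,
        Metric.ball_subset_closedBall, rfl⟩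
    · exact ⟨Metric.closedBall 0 r, Set.Iic r, by simp, measurableSet_closedBall,
        Metric.ball_subset_closedBall, subset_rfl, rfl⟩
  have hpreB : RealQuotient.proj c ρ ⁻¹' B
      = ⋃ g, (RealQuotient.twistedRealPoints c ρ g : Set X) ∩ S := by
    ext x
    simp only [hBS, Set.mem_preimage, Set.mem_ofPred_eq,
      RealQuotient.proj_mem_quotRealPoints_iff hreal,
      RealQuotient.quotDist_proj_zero hreal hinv, Set.mem_iUnion, Set.mem_inter_iff, hS,
      SetLike.mem_coe, RealQuotient.mem_twistedRealPoints, exists_and_right]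
  have hpreL : RealQuotient.proj c ρ ⁻¹' (RealQuotient.realImage c ρ ∩ B)
      = (RealQuotient.twistedRealPoints c ρ 1 : Set X) ∩ S := by
    ext x
    have h1 : x ∈ RealQuotient.twistedRealPoints c ρ 1 ↔ c.conj x = x := by
      simp [RealQuotient.mem_twistedRealPoints]
    rw [Set.preimage_inter, hpreB]
    simp only [Set.mem_inter_iff, Set.mem_preimage, Set.mem_iUnion, SetLike.mem_coe,
      RealQuotient.proj_mem_realImage_iff hreal, exists_and_right, ← h1]
    exact ⟨fun h => ⟨h.1, h.2.2⟩, fun h => ⟨h.1, ⟨1, h.1⟩, h.2⟩⟩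
  have hmeas := fun g =>
    (RealQuotient.isClosed_twistedRealPoints c ρ g).measurableSet.inter hSm
  have hBm : MeasurableSet B := by
    change MeasurableSet (RealQuotient.proj c ρ ⁻¹' B)
    rw [hpreB]
    exact MeasurableSet.iUnion hmeas
  have hLm : MeasurableSet (RealQuotient.realImage c ρ ∩ B) := by
    change MeasurableSet (RealQuotient.proj c ρ ⁻¹' (RealQuotient.realImage c ρ ∩ B))
    rw [hpreL]
    exact hmeas 1
  have hBr : B ⊆ RealQuotient.quotRealPoints c ρ := by
    rw [hBS]
    exact fun y hy => hy.1
  have hn := RealQuotient.finrank_twistedRealPoints_one c ρ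
  have hpos := RealQuotient.hausdorffMeasure_submodule_inter_pos
    (RealQuotient.twistedRealPoints c ρ 1) hr hball
  have hfin := RealQuotient.hausdorffMeasure_submodule_inter_lt_top
    (RealQuotient.twistedRealPoints c ρ 1) hclosed
  rw [hn] at hpos hfin
  rw [RealQuotient.vol_apply c ρ hBm hBr,
    RealQuotient.vol_apply c ρ hLm (Set.inter_subset_right.trans hBr), hpreB, hpreL,
    RealQuotient.hausdorffMeasure_iUnion_twistedRealPoints_inter hreal hfaithful hinv hS hSm]
  set m := μH[(Module.finrank ℂ X : ℝ)] ((RealQuotient.twistedRealPoints c ρ 1 : Set X) ∩ S)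
  have hk : ((RealQuotient.involutions G).ncard : ENNReal) ≠ 0 := by
    exact Nat.cast_ne_zero.2 (Set.ncard_ne_zero_of_mem (one_pow 2 : (1 : G) ^ 2 = 1))
  have hk' : ((RealQuotient.involutions G).ncard : ENNReal) ≠ ⊤ := ENNReal.natCast_ne_top _
  have hG : (Nat.card G : ENNReal)⁻¹ ≠ 0 := ENNReal.inv_ne_zero.2 (ENNReal.natCast_ne_top _)
  have hG' : (Nat.card G : ENNReal)⁻¹ ≠ ⊤ :=
    ENNReal.inv_ne_top.2 (Nat.cast_ne_zero.2 Nat.card_pos.ne')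
  refine ⟨hBm, hLm, ?_, ?_, ?_⟩
  · exact ENNReal.mul_pos hG (mul_ne_zero hk hpos.ne')
  · exact ENNReal.mul_lt_top hG'.lt_top (ENNReal.mul_lt_top hk'.lt_top hfin)
  · rw [ENNReal.mul_div_mul_left _ _ hG hG']
    simpa only [one_mul] using
      ENNReal.mul_div_mul_right 1 ((RealQuotient.involutions G).ncard : ENNReal) hpos.ne' hfin.ne
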